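/- Let $k$ be a field and let $\mathcal C$ be a skeletally small, Hom-finite, Krull–Schmidt triangulated $k$-category with suspension functor $\Sigma$ and with Serre duality, i.e. there are an autoequivalence $\nu$ of $\mathcal C$ and $k$-linear isomorphisms $\operatorname{Hom}_{\mathcal C}(X,Y)\simeq \operatorname{Hom}_k(\operatorname{Hom}_{\mathcal C}(Y,\nu X),k)$, natural in $X$ and $Y$. Let $T$ be a rigid object of $\mathcal C$, i.e. $\operatorname{Hom}_{\mathcal C}(T,\Sigma T)=0$, and let $\mathcal X_T$ be the class of objects $X$ of $\mathcal C$ with $\operatorname{Hom}_{\mathcal C}(T,X)=0$. Let $\mathcal C/\mathcal X_T$ be the factor category, which has the same objects as $\mathcal C$ and whose morphism groups are those of $\mathcal C$ modulo the morphisms that factor through an object of $\mathcal X_T$. Then $\mathcal C/\mathcal X_T$ is preabelian: it is an additive category in which every morphism has a kernel and a cokernel. -/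

import Mathlib

open CategoryTheory CategoryTheory.Limits

universe w v u

/-- A `k`-linear category is Hom-finite if all its morphism spaces are finite dimensional. -/
def IsHomFinite (k : Type*) [Field k] (C : Type u) [Category.{v} C] [Preadditive C]
    [Linear k C] : Prop :=
  ∀ X Y : C, FiniteDimensional k (X ⟶ Y)

/-- A category is Krull-Schmidt if every object is a finite (possibly empty) direct sum of objects
whose endomorphism rings are local. -/
def IsKrullSchmidt (C : Type u) [Category.{v} C] [Preadditive C]
    [HasFiniteBiproducts C] : Prop :=
  ∀ X : C, ∃ (n : ℕ) (Y : Fin n → C),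
    (∀ i, IsLocalRing (End (Y i))) ∧ Nonempty (X ≅ ⨁ Y)

/-- A Serre duality on a `k`-linear category: an autoequivalence `ν` with `k`-linear isomorphisms
`Hom(X, Y) ≃ D Hom(Y, ν X)`, natural in `X` and in `Y`, where `D = Hom_k(-, k)`. -/
structure SerreDuality (k : Type*) [Field k] (C : Type u) [Category.{v} C] [Preadditive C]
    [Linear k C] where
  /-- the autoequivalence `ν` -/
  ν : C ≌ C
  /-- the duality isomorphisms -/
  iso (X Y : C) : (X ⟶ Y) ≃ₗ[k] Module.Dual k (Y ⟶ ν.functor.obj X)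
  /-- naturality in the first variable -/
  natural_left {X X' Y : C} (a : X' ⟶ X) (f : X ⟶ Y) (h : Y ⟶ ν.functor.obj X') :
    iso X' Y (a ≫ f) h = iso X Y f (h ≫ ν.functor.map a)
  /-- naturality in the second variable -/
  natural_right {X Y Y' : C} (f : X ⟶ Y) (b : Y ⟶ Y') (h : Y' ⟶ ν.functor.obj X) :
    iso X Y' (f ≫ b) h = iso X Y f (b ≫ h)

/-- An object `T` of a category with shift `Σ = ⟦1⟧` is rigid if
`Ext¹(T, T) = Hom(T, Σ T)` is zero. -/
def IsRigid {C : Type u} [Category.{v} C] [Preadditive C] [HasShift C ℤ] (T : C) : Prop :=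
  ∀ f : T ⟶ T⟦(1 : ℤ)⟧, f = 0

/-- An additive category is preabelian if every morphism has a kernel and a cokernel.
(Additive: preadditive with all finite direct sums, the empty one included.) -/
class Preabelian (A : Type u) [Category.{v} A] [Preadditive A] : Prop extends
    HasFiniteBiproducts A, HasKernels A, HasCokernels A

section FactorCategory

variable {C : Type u} [Category.{v} C] [Preadditive C]

/-- The class `𝒳_T` of the objects `X` such that `Hom(T, X) = 0`. -/
def perpClass (T : C) : ObjectProperty C :=
  fun X => ∀ f : T ⟶ X, f = 0

/-- Two parallel morphisms are identified in `C / 𝒳_T` if their difference factors through an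
object of `𝒳_T`. -/
def factorRel (T : C) : HomRel C :=
  fun X Y f g => ∃ (U : C) (_ : perpClass T U) (a : X ⟶ U) (b : U ⟶ Y), a ≫ b = f - g

variable [HasFiniteBiproducts C]

attribute [local instance] hasBinaryBiproducts_of_finite_biproducts

lemma perpClass_biprod {T U V : C} (hU : perpClass T U) (hV : perpClass T V) :
    perpClass T (U ⊞ V) := by
  intro f
  ext
  · simpa using hU (f ≫ biprod.fst)
  · simpa using hV (f ≫ biprod.snd)

lemma factorRel_add (T : C) ⦃X Y : C⦄ (f₁ f₂ g₁ g₂ : X ⟶ Y)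
    (hf : factorRel T f₁ f₂) (hg : factorRel T g₁ g₂) :
    factorRel T (f₁ + g₁) (f₂ + g₂) := by
  obtain ⟨U, hU, a, b, h⟩ := hf
  obtain ⟨V, hV, c, d, h'⟩ := hg
  refine ⟨U ⊞ V, perpClass_biprod hU hV, biprod.lift a c, biprod.desc b d, ?_⟩
  rw [biprod.lift_desc, h, h']
  abel

instance factorRel_congruence (T : C) : Congruence (factorRel T) where
  comp_left := by
    rintro X Y Z f g g' ⟨U, hU, a, b, h⟩
    exact ⟨U, hU, f ≫ a, b, by rw [Category.assoc, h, Preadditive.comp_sub]⟩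
  comp_right := by
    rintro X Y Z f f' g ⟨U, hU, a, b, h⟩
    exact ⟨U, hU, a, b ≫ g, by rw [← Category.assoc, h, Preadditive.sub_comp]⟩
  equivalence := fun {X Y} =>
    { refl := fun f => by
        have := hasZeroObject_of_hasFiniteBiproducts C
        obtain ⟨Z, hZ⟩ := HasZeroObject.zero (C := C)
        exact ⟨Z, fun g => hZ.eq_of_tgt g 0, 0, 0, by simp⟩
      symm := by
        rintro f g ⟨U, hU, a, b, h⟩
        exact ⟨U, hU, a, -b, by rw [Preadditive.comp_neg, h, neg_sub]⟩
      trans := by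
        rintro f g l ⟨U, hU, a, b, h⟩ ⟨V, hV, c, d, h'⟩
        refine ⟨U ⊞ V, perpClass_biprod hU hV, biprod.lift a c, biprod.desc b d, ?_⟩
        rw [biprod.lift_desc, h, h']
        abel }

/-- The factor category `C / 𝒳_T`: the objects are those of `C`, and morphisms are those of `C`
modulo the ones that factor through an object of `𝒳_T`. -/
abbrev FactorCategory (T : C) : Type u :=
  CategoryTheory.Quotient (factorRel T)

/-- The addition of morphisms in `C / 𝒳_T` is induced by that of `C`. -/
instance FactorCategory.preadditive (T : C) : Preadditive (FactorCategory T) :=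
  CategoryTheory.Quotient.preadditive (factorRel T) (factorRel_add T)

end FactorCategory

/-! Cokernels: let `b : R ⟶ X` be a right `add T`-approximation. Rigidity puts its cone in `𝒳_T`, so
in the factor category a morphism out of `X` vanishes once its composite with `b` does. Hence the
cone of `b ≫ f` is a candidate cokernel of `f`; it works because `Hom(R, 𝒳_T) = 0` and `R⟦1⟧` lies
in `𝒳_T`. Kernels are dual, with `ν T` for `T`: by Serre duality `𝒳_T` is also the class of `V` with
`Hom(V, ν T) = 0`, and rigidity puts `(ν T)⟦-1⟧` in `𝒳_T`. The fibre of `f ≫ b`, for `b` a left `add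
(ν T)`-approximation of the target, is the kernel. -/

section Approximation

variable {k : Type*} [Field k] {C : Type u} [Category.{v} C] [Preadditive C] [Linear k C]
  [HasFiniteBiproducts C]

/-- In a Hom-finite category, every object has a left `add A`-approximation. -/
lemma IsHomFinite.exists_left_approximation (hfin : IsHomFinite k C) (X A : C) :
    ∃ (n : ℕ) (b : X ⟶ ⨁ fun _ : Fin n => A), ∀ g : X ⟶ A, ∃ c, b ≫ c = g := by
  have := hfin X A
  let B := Module.finBasis k (X ⟶ A)
  -- One copy of `A` per basis vector of `X ⟶ A`; the coordinates of `g` give the factorization.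
  refine ⟨_, biproduct.lift fun i => B i, fun g => ⟨biproduct.desc fun i => B.repr g i • 𝟙 A, ?_⟩⟩
  rw [biproduct.lift_desc]
  simp [B.sum_repr g]

/-- In a Hom-finite category, every object has a right `add A`-approximation. -/
lemma IsHomFinite.exists_right_approximation (hfin : IsHomFinite k C) (A X : C) :
    ∃ (n : ℕ) (b : (⨁ fun _ : Fin n => A) ⟶ X), ∀ g : A ⟶ X, ∃ c, c ≫ b = g := by
  have := hfin A X
  let B := Module.finBasis k (A ⟶ X)
  refine ⟨_, biproduct.desc fun i => B i, fun g => ⟨biproduct.lift fun i => B.repr g i • 𝟙 A, ?_⟩⟩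
  rw [biproduct.lift_desc]
  simp [B.sum_repr g]

end Approximation

section Serre

variable {k : Type*} [Field k] {C : Type u} [Category.{v} C] [Preadditive C] [Linear k C]

/-- By Serre duality, `Hom(X, Y)` vanishes if and only if `Hom(Y, ν X)` does. -/
lemma SerreDuality.forall_eq_zero_iff (S : SerreDuality k C) (X Y : C) :
    (∀ f : X ⟶ Y, f = 0) ↔ ∀ g : Y ⟶ S.ν.functor.obj X, g = 0 := by
  constructor
  · intro h g
    rw [← Module.forall_dual_apply_eq_zero_iff k]
    intro φ
    obtain ⟨f, rfl⟩ := (S.iso X Y).surjective φ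
    simp [h f]
  · intro h f
    apply (S.iso X Y).injective
    ext g
    simp [h g]

variable [HasShift C ℤ]

/-- If `T` is rigid and `ν` is a Serre functor, then `(ν T)⟦-1⟧` lies in `𝒳_T`. -/
lemma SerreDuality.perpClass_shift_neg_one (S : SerreDuality k C) {T : C} (hT : IsRigid T) :
    perpClass T ((S.ν.functor.obj T)⟦(-1 : ℤ)⟧) := by
  -- Serre duality turns rigidity into `Hom(T⟦1⟧, ν T) = 0`; the shift adjunction then moves the
  -- shift across.
  have h := (S.forall_eq_zero_iff T (T⟦(1 : ℤ)⟧)).1 hT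
  intro f
  let e := (shiftEquiv C (1 : ℤ)).toAdjunction.homEquiv T (S.ν.functor.obj T)
  have he : e 0 = 0 := by
    simp [e, Adjunction.homEquiv_unit]
  exact (e.apply_symm_apply f).symm.trans ((congrArg e (h _)).trans he)

end Serre

/-! ### Kernels and cokernels in the factor category, tested in `C`. -/

section FactorCategory

variable {C : Type u} [Category.{v} C] [Preadditive C] [HasFiniteBiproducts C]

lemma FactorCategory.map_eq_zero_iff (T : C) {X Y : C} (f : X ⟶ Y) :
    (Quotient.functor (factorRel T)).map f = 0 ↔
      ∃ (U : C) (_ : perpClass T U) (a : X ⟶ U) (b : U ⟶ Y), a ≫ b = f := by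
  have : (0 : (Quotient.functor (factorRel T)).obj X ⟶ (Quotient.functor (factorRel T)).obj Y) =
    (Quotient.functor (factorRel T)).map 0 := rfl
  rw [this, Quotient.functor_map_eq_iff]
  simp only [factorRel, sub_zero]

instance FactorCategory.functor_additive (T : C) : (Quotient.functor (factorRel T)).Additive where
  map_add := rfl

instance FactorCategory.hasFiniteBiproducts (T : C) : HasFiniteBiproducts (FactorCategory T) where
  out _ :=
    { has_biproduct := fun F => HasBiproduct.mk
        { bicone := (Quotient.functor (factorRel T)).mapBicone
            (biproduct.bicone fun i => (F i).as)
          isBilimit := isBilimitOfPreserves (Quotient.functor (factorRel T))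
            (biproduct.isBilimit fun i => (F i).as) } }

/-- `κ` becomes a kernel of `f` in `C / 𝒳_T` if its composite with `f` factors through `𝒳_T`,
the morphisms `g` such that `g ≫ f` factors through `𝒳_T` factor through `κ`, and `κ` reflects
factoring through `𝒳_T`. -/
lemma FactorCategory.hasKernel (T : C) {K X Y : C} (f : X ⟶ Y) (κ : K ⟶ X)
    (w : (Quotient.functor (factorRel T)).map (κ ≫ f) = 0)
    (lift : ∀ {W : C} (g : W ⟶ X), (Quotient.functor (factorRel T)).map (g ≫ f) = 0 →
      ∃ l : W ⟶ K, l ≫ κ = g)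
    (mono : ∀ {W : C} (h : W ⟶ K), (Quotient.functor (factorRel T)).map (h ≫ κ) = 0 →
      (Quotient.functor (factorRel T)).map h = 0) :
    HasKernel ((Quotient.functor (factorRel T)).map f) := by
  let Q := Quotient.functor (factorRel T)
  have hmono : Mono (Q.map κ) := by
    refine Preadditive.mono_of_cancel_zero _ fun {W} h hh => ?_
    obtain ⟨h, rfl⟩ := Q.map_surjective (X := W.as) h
    exact mono h (by rw [Functor.map_comp]; exact hh)
  have hlift (W : FactorCategory T) (g : W ⟶ Q.obj X) (hg : g ≫ Q.map f = 0) :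
      ∃ l : W ⟶ Q.obj K, l ≫ Q.map κ = g := by
    obtain ⟨g, rfl⟩ := Q.map_surjective (X := W.as) g
    obtain ⟨l, rfl⟩ := lift g (by rw [Functor.map_comp]; exact hg)
    exact ⟨Q.map l, (Q.map_comp _ _).symm⟩
  choose l hl using hlift
  exact ⟨⟨_, KernelFork.IsLimit.ofι (Q.map κ) ((Q.map_comp _ _).symm.trans w)
    (fun g hg => l _ g hg) (fun g hg => hl _ g hg)
    (fun g hg m hm => (cancel_mono (Q.map κ)).1 (hm.trans (hl _ g hg).symm))⟩⟩

/-- `c` becomes a cokernel of `f` in `C / 𝒳_T` if its composite with `f` factors through `𝒳_T`,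
the morphisms `g` such that `f ≫ g` factors through `𝒳_T` factor through `c`, and `c` reflects
factoring through `𝒳_T`. -/
lemma FactorCategory.hasCokernel (T : C) {X Y Z : C} (f : X ⟶ Y) (c : Y ⟶ Z)
    (w : (Quotient.functor (factorRel T)).map (f ≫ c) = 0)
    (desc : ∀ {W : C} (g : Y ⟶ W), (Quotient.functor (factorRel T)).map (f ≫ g) = 0 →
      ∃ d : Z ⟶ W, c ≫ d = g)
    (epi : ∀ {W : C} (h : Z ⟶ W), (Quotient.functor (factorRel T)).map (c ≫ h) = 0 →
      (Quotient.functor (factorRel T)).map h = 0) :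
    HasCokernel ((Quotient.functor (factorRel T)).map f) := by
  let Q := Quotient.functor (factorRel T)
  have hepi : Epi (Q.map c) := by
    refine Preadditive.epi_of_cancel_zero _ fun {W} h hh => ?_
    obtain ⟨h, rfl⟩ := Q.map_surjective (Y := W.as) h
    exact epi h (by rw [Functor.map_comp]; exact hh)
  have hdesc (W : FactorCategory T) (g : Q.obj Y ⟶ W) (hg : Q.map f ≫ g = 0) :
      ∃ d : Q.obj Z ⟶ W, Q.map c ≫ d = g := by
    obtain ⟨g, rfl⟩ := Q.map_surjective (Y := W.as) g
    obtain ⟨d, rfl⟩ := desc g (by rw [Functor.map_comp]; exact hg)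
    exact ⟨Q.map d, (Q.map_comp _ _).symm⟩
  choose d hd using hdesc
  exact ⟨⟨_, CokernelCofork.IsColimit.ofπ (Q.map c) ((Q.map_comp _ _).symm.trans w)
    (fun g hg => d _ g hg) (fun g hg => hd _ g hg)
    (fun g hg m hm => (cancel_epi (Q.map c)).1 (hm.trans (hd _ g hg).symm))⟩⟩

end FactorCategory

/-! ### Kernels and cokernels from distinguished triangles. -/

section Triangulated

open Pretriangulated

variable {C : Type u} [Category.{v} C] [Preadditive C] [HasZeroObject C] [HasShift C ℤ]
  [∀ n : ℤ, (shiftFunctor C n).Additive] [Pretriangulated C]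

/-- Let `b : Y ⟶ R` be a morphism with fibre in `𝒳_T`, such that `R⟦-1⟧` lies in `𝒳_T` and
`Hom(U, R) = 0` for `U` in `𝒳_T`. Then the fibre of `f ≫ b` is a kernel of `f` in `C / 𝒳_T`. -/
lemma FactorCategory.hasKernel_of_triangle {T X Y U R : C} (f : X ⟶ Y) {a : U ⟶ Y} {b : Y ⟶ R}
    {δ : R ⟶ U⟦(1 : ℤ)⟧} (hdist : Triangle.mk a b δ ∈ distTriang C) (hU : perpClass T U)
    (hR : perpClass T (R⟦(-1 : ℤ)⟧)) (hzero : ∀ V : C, perpClass T V → ∀ g : V ⟶ R, g = 0) :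
    HasKernel ((Quotient.functor (factorRel T)).map f) := by
  obtain ⟨K, κ, ε, hK⟩ := distinguished_cocone_triangle₁ (f ≫ b)
  have hκ : κ ≫ f ≫ b = 0 := comp_distTriang_mor_zero₁₂ _ hK
  refine FactorCategory.hasKernel T f κ ?_ ?_ ?_
  · obtain ⟨l, hl⟩ := Triangle.coyoneda_exact₂ _ hdist (κ ≫ f)
      ((Category.assoc _ _ _).trans hκ)
    exact (map_eq_zero_iff T _).2 ⟨U, hU, l, a, hl.symm⟩
  · intro W g hg
    obtain ⟨V, hV, p, q, hpq⟩ := (map_eq_zero_iff T _).1 hg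
    -- As `Hom(V, R) = 0`, the composite `g ≫ f ≫ b` vanishes in `C` itself, so `g` lifts strictly.
    obtain ⟨l, hl⟩ := Triangle.coyoneda_exact₂ _ hK g (by
      change g ≫ f ≫ b = 0
      rw [← Category.assoc, ← hpq, Category.assoc, hzero V hV (q ≫ b), comp_zero])
    exact ⟨l, hl.symm⟩
  · intro W h hh
    obtain ⟨V, hV, p, q, hpq⟩ := (map_eq_zero_iff T _).1 hh
    obtain ⟨l, hl⟩ := Triangle.coyoneda_exact₂ _ hK q (hzero V hV _)
    change V ⟶ K at l
    change q = l ≫ κ at hl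
    -- Subtracting `p ≫ l`, which factors through `V`, leaves a map killed by `κ`, hence one through
    -- `R⟦-1⟧`.
    obtain ⟨m, hm⟩ := Triangle.coyoneda_exact₂ _ (inv_rot_of_distTriang _ hK) (h - p ≫ l) (by
      change (h - p ≫ l) ≫ κ = 0
      rw [Preadditive.sub_comp, Category.assoc, ← hl, hpq, sub_self])
    have h₁ : (Quotient.functor (factorRel T)).map (h - p ≫ l) = 0 :=
      (map_eq_zero_iff T _).2 ⟨_, hR, m, _, hm.symm⟩
    have h₂ : (Quotient.functor (factorRel T)).map (p ≫ l) = 0 :=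
      (map_eq_zero_iff T _).2 ⟨V, hV, p, l, rfl⟩
    rw [← sub_add_cancel h (p ≫ l), Functor.map_add, h₁, h₂, add_zero]

/-- Let `b : R ⟶ X` be a morphism with cone in `𝒳_T`, such that `R⟦1⟧` lies in `𝒳_T` and
`Hom(R, U) = 0` for `U` in `𝒳_T`. Then the cone of `b ≫ f` is a cokernel of `f` in `C / 𝒳_T`. -/
lemma FactorCategory.hasCokernel_of_triangle {T X Y U R : C} (f : X ⟶ Y) {b : R ⟶ X} {a : X ⟶ U}
    {δ : U ⟶ R⟦(1 : ℤ)⟧} (hdist : Triangle.mk b a δ ∈ distTriang C) (hU : perpClass T U)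
    (hR : perpClass T (R⟦(1 : ℤ)⟧)) (hzero : ∀ V : C, perpClass T V → ∀ g : R ⟶ V, g = 0) :
    HasCokernel ((Quotient.functor (factorRel T)).map f) := by
  obtain ⟨Z, c, ε, hZ⟩ := distinguished_cocone_triangle (b ≫ f)
  have hc : (b ≫ f) ≫ c = 0 := comp_distTriang_mor_zero₁₂ _ hZ
  refine FactorCategory.hasCokernel T f c ?_ ?_ ?_
  · obtain ⟨l, hl⟩ := Triangle.yoneda_exact₂ _ hdist (f ≫ c)
      ((Category.assoc _ _ _).symm.trans hc)
    exact (map_eq_zero_iff T _).2 ⟨U, hU, a, l, hl.symm⟩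
  · intro W g hg
    obtain ⟨V, hV, p, q, hpq⟩ := (map_eq_zero_iff T _).1 hg
    obtain ⟨l, hl⟩ := Triangle.yoneda_exact₂ _ hZ g (by
      change (b ≫ f) ≫ g = 0
      rw [Category.assoc, ← hpq, ← Category.assoc, hzero V hV (b ≫ p), zero_comp])
    exact ⟨l, hl.symm⟩
  · intro W h hh
    obtain ⟨V, hV, p, q, hpq⟩ := (map_eq_zero_iff T _).1 hh
    obtain ⟨l, hl⟩ := Triangle.yoneda_exact₂ _ hZ p (hzero V hV _)
    change Z ⟶ V at l
    change p = c ≫ l at hl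
    -- The corrected map is killed by `c`, so it factors through `R⟦1⟧`.
    obtain ⟨m, hm⟩ := Triangle.yoneda_exact₃ _ hZ (h - l ≫ q) (by
      change c ≫ (h - l ≫ q) = 0
      rw [Preadditive.comp_sub, ← Category.assoc, ← hl, hpq, sub_self])
    have h₁ : (Quotient.functor (factorRel T)).map (h - l ≫ q) = 0 :=
      (map_eq_zero_iff T _).2 ⟨_, hR, _, m, hm.symm⟩
    have h₂ : (Quotient.functor (factorRel T)).map (l ≫ q) = 0 :=
      (map_eq_zero_iff T _).2 ⟨V, hV, l, q, rfl⟩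
    rw [← sub_add_cancel h (l ≫ q), Functor.map_add, h₁, h₂, add_zero]

end Triangulated

/-! ### Approximation triangles with third term in `𝒳_T`. -/

section Preabelian

open Pretriangulated

variable {k : Type*} [Field k] {C : Type u} [Category.{v} C] [Preadditive C] [Linear k C]
  [HasZeroObject C] [HasShift C ℤ] [∀ n : ℤ, (shiftFunctor C n).Additive] [Pretriangulated C]

lemma perpClass_map_biproduct {T V : C} {n : ℕ} (F : C ⥤ C) [F.Additive]
    (h : perpClass T (F.obj V)) : perpClass T (F.obj (⨁ fun _ : Fin n => V)) := by
  intro f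
  rw [← cancel_mono (F.mapBiproduct fun _ : Fin n => V).hom]
  refine biproduct.hom_ext _ _ fun i => ?_
  exact (h _).trans (h _).symm

lemma FactorCategory.hasCokernels (hfin : IsHomFinite k C) {T : C} (hT : IsRigid T) :
    HasCokernels (FactorCategory T) where
  has_colimit {X Y} f := by
    obtain ⟨f, rfl⟩ := (Quotient.functor (factorRel T)).map_surjective (X := X.as) (Y := Y.as) f
    obtain ⟨n, b, hb⟩ := hfin.exists_right_approximation T X.as
    obtain ⟨U, a, δ, hdist⟩ := distinguished_cocone_triangle b
    have hR : perpClass T ((⨁ fun _ : Fin n => T)⟦(1 : ℤ)⟧) :=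
      perpClass_map_biproduct (shiftFunctor C (1 : ℤ)) hT
    refine hasCokernel_of_triangle f hdist (fun g => ?_) hR
      fun V hV g => biproduct.hom_ext' _ _ fun i => (hV _).trans (hV _).symm
    -- A map `T ⟶ U` lifts to `X` because `Hom(T, R⟦1⟧) = 0`, then factors through `b`, so it dies
    -- in `U`.
    obtain ⟨l, rfl⟩ := Triangle.coyoneda_exact₃ _ hdist g (hR _)
    change T ⟶ X.as at l
    obtain ⟨c, rfl⟩ := hb l
    exact (Category.assoc _ _ _).trans
      ((congrArg (c ≫ ·) (comp_distTriang_mor_zero₁₂ _ hdist)).trans comp_zero)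

lemma FactorCategory.hasKernels (hfin : IsHomFinite k C) (S : SerreDuality k C) {T : C}
    (hT : IsRigid T) : HasKernels (FactorCategory T) where
  has_limit {X Y} f := by
    obtain ⟨f, rfl⟩ := (Quotient.functor (factorRel T)).map_surjective (X := X.as) (Y := Y.as) f
    obtain ⟨n, b, hb⟩ := hfin.exists_left_approximation Y.as (S.ν.functor.obj T)
    obtain ⟨U, a, δ, hdist⟩ := distinguished_cocone_triangle₁ b
    have hR : perpClass T ((⨁ fun _ : Fin n => S.ν.functor.obj T)⟦(-1 : ℤ)⟧) :=
      perpClass_map_biproduct (shiftFunctor C (-1 : ℤ)) (S.perpClass_shift_neg_one hT)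
    have hzero (V : C) (hV : perpClass T V) := (S.forall_eq_zero_iff T V).1 hV
    refine hasKernel_of_triangle f hdist ((S.forall_eq_zero_iff T U).2 fun g => ?_) hR
      fun V hV g => biproduct.hom_ext _ _ fun i => (hzero V hV _).trans (hzero V hV _).symm
    -- A map `U ⟶ ν T` vanishes on `R⟦-1⟧`, so it extends along `a` to `Y`; that extension factors
    -- through `b`, and `a ≫ b = 0`.
    obtain ⟨l, rfl⟩ := Triangle.yoneda_exact₂ _ (inv_rot_of_distTriang _ hdist) g (hzero _ hR _)
    change Y.as ⟶ _ at l
    obtain ⟨c, rfl⟩ := hb l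
    exact (Category.assoc _ _ _).symm.trans
      ((congrArg (· ≫ c) (comp_distTriang_mor_zero₁₂ _ hdist)).trans zero_comp)

end Preabelian

theorem theorem3p1 {k : Type*} [Field k] {C : Type u} [Category.{v} C] [EssentiallySmall.{w} C]
    [Preadditive C] [Linear k C] [HasZeroObject C] [HasShift C ℤ]
    [∀ n : ℤ, (shiftFunctor C n).Additive] [∀ n : ℤ, (shiftFunctor C n).Linear k]
    [Pretriangulated C] [IsTriangulated C]
    (hfin : IsHomFinite k C) (hKS : IsKrullSchmidt C) (S : SerreDuality k C)
    (T : C) (hT : IsRigid T) :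
    Preabelian (FactorCategory T) where
  toHasFiniteBiproducts := FactorCategory.hasFiniteBiproducts T
  toHasKernels := FactorCategory.hasKernels hfin S hT
  toHasCokernels := FactorCategory.hasCokernels hfin hT
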